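/- Let $n\ge 1$ and let $G$ be a simple undirected graph on the vertices $1,\dots,n$ in which every edge $ij$ carries a weight $w_{ij}>0$. Let $W(G)$ be its weight matrix (with entry $w_{ij}$ if $ij$ is an edge and $0$ otherwise), let $d=(d_1,\dots,d_n)^\top$ be the sequence of its vertex degrees (the numbers of neighbours, regardless of the weights), and let $L=\operatorname{diag}(W(G)\mathbf 1)-W(G)$ be its weighted Laplacian matrix, where $\mathbf 1$ is the all-ones column vector. Let $G^{-1}$ be the same graph with every weight $w_{ij}$ replaced by $1/w_{ij}$. Let $D$ be a real symmetric $n\times n$ matrix with zero diagonal such that $D\ge W(G^{-1})$ entrywise. Suppose that all the entries of $$LD+2I-(2\cdot\mathbf 1-d)\mathbf 1^\top$$ strictly above the main diagonal are zero. Then $G$ is a tree, and $D$ is the distance matrix of $G^{-1}$, i.e. for all $i,j$ the entry $D_{ij}$ is the minimum, over the paths from $i$ to $j$, of the sum of the weights $1/w_{kl}$ of the edges $kl$ of the path. Consequently the remaining (diagonal and lower-triangular) equations hold as well: $LD+2I=(2\cdot\mathbf 1-d)\mathbf 1^\top$. -/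

import Mathlib

open scoped Matrix

/-- A simple undirected graph with a positive real weight on every edge. -/
structure WeightedGraph (V : Type*) where
  graph : SimpleGraph V
  weight : graph.edgeSet → ℝ
  weight_pos : ∀ e, 0 < weight e

namespace WeightedGraph

variable {V : Type*}

/-- The graph with the same edges and with all the weights replaced by their reciprocals. -/
noncomputable instance : Inv (WeightedGraph V) where
  inv G :=
    { graph := G.graph
      weight := fun e => (G.weight e)⁻¹
      weight_pos := fun e => inv_pos.mpr (G.weight_pos e) }

open Classical in
/-- The weight matrix `W(G)`: the weight of `ij` if `ij` is an edge, and `0` otherwise. -/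
noncomputable def weightMatrix (G : WeightedGraph V) : Matrix V V ℝ :=
  Matrix.of fun i j =>
    if h : G.graph.Adj i j then G.weight ⟨s(i, j), (SimpleGraph.mem_edgeSet G.graph).mpr h⟩ else 0

open Classical in
/-- The degree sequence `d(G) = X(G) 1`, where `X(G)` is the 0-1 adjacency matrix
(weights play no role). -/
noncomputable def degreeVec [Fintype V] (G : WeightedGraph V) : V → ℝ :=
  G.graph.adjMatrix ℝ *ᵥ 1

/-- The Laplacian matrix `L(G) = diag (W(G) 1) - W(G)`. -/
noncomputable def laplacian [Fintype V] [DecidableEq V] (G : WeightedGraph V) : Matrix V V ℝ :=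
  Matrix.diagonal (G.weightMatrix *ᵥ 1) - G.weightMatrix

/-- The weight of a walk: the sum of the weights of the edges that it traverses. -/
noncomputable def walkWeight (G : WeightedGraph V) {i j : V} (p : G.graph.Walk i j) : ℝ :=
  (p.darts.map fun e => G.weightMatrix e.fst e.snd).sum

/-- `D` is the distance matrix of `G`: every entry `D i j` is the (attained) minimum of the weights
of the paths from `i` to `j`. In particular all the paths asked for exist, and `D i i = 0`,
the only path from `i` to `i` being the trivial one. -/
def IsDistanceMatrix (G : WeightedGraph V) (D : Matrix V V ℝ) : Prop :=
  ∀ i j, IsLeast {x : ℝ | ∃ p : G.graph.Walk i j, p.IsPath ∧ G.walkWeight p = x} (D i j)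

end WeightedGraph

/-- The strictly upper triangular part of a square matrix. -/
def strictUpper {n : ℕ} (A : Matrix (Fin n) (Fin n) ℝ) : Matrix (Fin n) (Fin n) ℝ :=
  Matrix.of fun i j => if i < j then A i j else 0

/-!
Apply `L` to a column `f` of `D` and sum over a union `S` of connected components: the total is `0`.
If `f` is the column of the largest vertex `m` of `S`, then the equations above the diagonal give
`(L f) i = 2 - d i` for `i ≠ m`, while `D ≥ W(G⁻¹)` gives `(L f) m ≤ -d m`; so
`∑ i ∈ S, (2 - d i) ≥ 2`. If `S` misses the largest vertex of `G`, then the column of that vertex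
gives `∑ i ∈ S, (2 - d i) = 0` instead. Hence `G` is connected, and `S = V` gives `#E ≤ #V - 1`, so
`G` is a tree. The distance matrix of `G⁻¹` satisfies all the equations, because in a tree exactly
one neighbour of `i` is closer to `j` than `i` is. It equals `D`: taking the columns from the last
to the first, the difference of the two `j`-th columns vanishes at `j` and, by symmetry, beyond `j`,
and is harmonic elsewhere.
-/

theorem isTree_of_connected_of_sum_degree_add_two_le {V : Type*} [Fintype V] {G : SimpleGraph V}
    [DecidableRel G.Adj] (hG : G.Connected)
    (h : ∑ i, G.degree i + 2 ≤ 2 * Fintype.card V) : G.IsTree := by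
  classical
  refine SimpleGraph.isTree_iff_connected_and_card.2
    ⟨hG, le_antisymm ?_ hG.card_vert_le_card_edgeSet_add_one⟩
  rw [SimpleGraph.sum_degrees_eq_twice_card_edges, SimpleGraph.edgeFinset_card] at h
  rw [Nat.card_eq_fintype_card, Nat.card_eq_fintype_card]
  lia

namespace WeightedGraph

variable {V : Type*} {G : WeightedGraph V}

section WeightMatrix

theorem weightMatrix_pos {i j : V} (h : G.graph.Adj i j) : 0 < G.weightMatrix i j := by
  simp only [weightMatrix, Matrix.of_apply, h, dite_true, G.weight_pos]

theorem weightMatrix_eq_zero {i j : V} (h : ¬G.graph.Adj i j) : G.weightMatrix i j = 0 := by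
  simp only [weightMatrix, Matrix.of_apply, h, dite_false]

variable (G)

theorem weightMatrix_nonneg (i j : V) : 0 ≤ G.weightMatrix i j := by
  by_cases h : G.graph.Adj i j
  · exact (weightMatrix_pos h).le
  · exact (weightMatrix_eq_zero h).ge

theorem isSymm_weightMatrix : G.weightMatrix.IsSymm := by
  refine Matrix.IsSymm.ext fun i j => ?_
  by_cases h : G.graph.Adj i j
  · simp only [weightMatrix, Matrix.of_apply, h, h.symm, dite_true, Sym2.eq_swap]
  · rw [weightMatrix_eq_zero h, weightMatrix_eq_zero fun h' => h h'.symm]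

theorem inv_weightMatrix_apply (i j : V) :
    G⁻¹.weightMatrix i j = (G.weightMatrix i j)⁻¹ := by
  by_cases h : G.graph.Adj i j
  · have h' : G⁻¹.graph.Adj i j := h
    simp only [weightMatrix, Matrix.of_apply, dif_pos h, dif_pos h']
    rfl
  · rw [weightMatrix_eq_zero h, inv_zero]
    exact G⁻¹.weightMatrix_eq_zero h

variable {G}

theorem weightMatrix_mul_eq_zero_iff {i j : V} {x : ℝ} :
    G.weightMatrix i j * x = 0 ↔ (G.graph.Adj i j → x = 0) := by
  by_cases h : G.graph.Adj i j
  · simp only [h, true_imp_iff, mul_eq_zero, (weightMatrix_pos h).ne', false_or]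
  · simp only [h, false_imp_iff, weightMatrix_eq_zero h, zero_mul]

end WeightMatrix

section DistanceMatrix

@[simp]
theorem walkWeight_nil (G : WeightedGraph V) (i : V) :
    G.walkWeight (SimpleGraph.Walk.nil : G.graph.Walk i i) = 0 := rfl

@[simp]
theorem walkWeight_cons {i j k : V} (h : G.graph.Adj i j) (p : G.graph.Walk j k) :
    G.walkWeight (p.cons h) = G.weightMatrix i j + G.walkWeight p := by
  simp only [walkWeight, SimpleGraph.Walk.darts_cons, List.map_cons, List.sum_cons]

theorem walkWeight_reverse {i j : V} (p : G.graph.Walk i j) :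
    G.walkWeight p.reverse = G.walkWeight p := by
  simp only [walkWeight, SimpleGraph.Walk.darts_reverse, List.map_reverse, List.sum_reverse,
    List.map_map]
  congr 1
  exact List.map_congr_left fun e _ => G.isSymm_weightMatrix.apply _ _

theorem exists_isDistanceMatrix [Finite V] (hG : G.graph.Preconnected) :
    ∃ E, G.IsDistanceMatrix E := by
  classical
  have := Fintype.ofFinite V
  have (i j : V) : Nonempty (G.graph.Path i j) :=
    Nonempty.map SimpleGraph.Walk.toPath (hG i j)
  choose p hp using fun i j => Finite.exists_min fun p : G.graph.Path i j => G.walkWeight p.1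
  refine ⟨Matrix.of fun i j => G.walkWeight (p i j).1, fun i j => ⟨⟨_, (p i j).2, rfl⟩, ?_⟩⟩
  rintro _ ⟨q, hq, rfl⟩
  exact hp i j ⟨q, hq⟩

namespace IsDistanceMatrix

variable {E : Matrix V V ℝ}

theorem apply_self (hE : G.IsDistanceMatrix E) (i : V) : E i i = 0 := by
  obtain ⟨q, hq, h⟩ := (hE i i).1
  rw [← h, (SimpleGraph.Walk.isPath_iff_nil.1 hq).eq_nil, walkWeight_nil]

theorem isSymm (hE : G.IsDistanceMatrix E) : E.IsSymm := by
  have hle (i j) : E i j ≤ E j i := by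
    obtain ⟨p, hp, h⟩ := (hE j i).1
    exact (hE i j).2 ⟨p.reverse, hp.reverse, by rw [walkWeight_reverse, h]⟩
  exact Matrix.IsSymm.ext fun i j => (hle j i).antisymm (hle i j)

theorem walkWeight_eq (hE : G.IsDistanceMatrix E) (hG : G.graph.IsAcyclic) {i j : V}
    {p : G.graph.Walk i j} (hp : p.IsPath) : G.walkWeight p = E i j := by
  obtain ⟨q, hq, h⟩ := (hE i j).1
  rw [← h, show p = q from congrArg Subtype.val
    ((hG.subsingleton_path i j).elim ⟨p, hp⟩ ⟨q, hq⟩)]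

theorem apply_of_adj (hE : G.IsDistanceMatrix E) (hG : G.graph.IsAcyclic) {i j : V}
    (h : G.graph.Adj i j) : E i j = G.weightMatrix i j := by
  have hp : (SimpleGraph.Walk.nil.cons h).IsPath := by simpa using h.ne
  rw [← hE.walkWeight_eq hG hp, walkWeight_cons, walkWeight_nil, add_zero]

theorem exists_adj_apply_eq_add (hE : G.IsDistanceMatrix E) (hG : G.graph.IsAcyclic) {i j : V}
    (hij : i ≠ j) :
    ∃ k, G.graph.Adj i k ∧ E i j = G.weightMatrix i k + E k j ∧
      ∀ l ≠ k, G.graph.Adj i l → E l j = G.weightMatrix i l + E i j := by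
  obtain ⟨p, hp, -⟩ := (hE i j).1
  cases p with
  | nil => exact absurd rfl hij
  | @cons _ k _ h q =>
    refine ⟨k, h, ?_, fun l hlk hl => ?_⟩
    · rw [← hE.walkWeight_eq hG hp, walkWeight_cons, hE.walkWeight_eq hG hp.of_cons]
    · have hl_support : l ∉ (q.cons h).support := fun hmem =>
        hlk (by simpa using hG.eq_snd_of_adj_start hp hl hmem)
      have hp' : ((q.cons h).cons hl.symm).IsPath := hp.cons hl_support
      rw [← hE.walkWeight_eq hG hp', walkWeight_cons, hE.walkWeight_eq hG hp,
        G.isSymm_weightMatrix.apply]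

end IsDistanceMatrix

end DistanceMatrix

section Laplacian

variable [Fintype V]

open Classical in
theorem degreeVec_apply (G : WeightedGraph V) (i : V) : G.degreeVec i = G.graph.degree i :=
  (G.graph.adjMatrix_mulVec_const_apply (a := 1)).trans (mul_one _)

theorem degreeVec_eq_sum (G : WeightedGraph V) (i : V) :
    G.degreeVec i = ∑ k, G.weightMatrix i k * G⁻¹.weightMatrix i k := by
  classical
  simp only [degreeVec, Matrix.mulVec, dotProduct, Pi.one_apply, mul_one,
    SimpleGraph.adjMatrix_apply, inv_weightMatrix_apply]
  refine Finset.sum_congr rfl fun k _ => ?_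
  split_ifs with h
  · rw [mul_inv_cancel₀ (weightMatrix_pos h).ne']
  · rw [weightMatrix_eq_zero h, zero_mul]

variable [DecidableEq V]

theorem laplacian_mulVec_apply (G : WeightedGraph V) (f : V → ℝ) (i : V) :
    (G.laplacian *ᵥ f) i = ∑ k, G.weightMatrix i k * (f i - f k) := by
  rw [laplacian, Matrix.sub_mulVec, Pi.sub_apply, Matrix.mulVec_diagonal]
  simp only [Matrix.mulVec, dotProduct, Pi.one_apply, mul_one, mul_sub, Finset.sum_sub_distrib,
    Finset.sum_mul]

theorem laplacian_mulVec_apply_add_degreeVec (G : WeightedGraph V) (f : V → ℝ) (i : V) :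
    (G.laplacian *ᵥ f) i + G.degreeVec i
      = ∑ k, G.weightMatrix i k * (f i - f k + G⁻¹.weightMatrix i k) := by
  simp only [laplacian_mulVec_apply, degreeVec_eq_sum, mul_add, Finset.sum_add_distrib]

theorem laplacian_mulVec_apply_le_neg_degreeVec {f : V → ℝ} {i : V}
    (hf : ∀ k, G.graph.Adj i k → G⁻¹.weightMatrix i k ≤ f k - f i) :
    (G.laplacian *ᵥ f) i ≤ -G.degreeVec i := by
  rw [le_neg_iff_add_nonpos_right, laplacian_mulVec_apply_add_degreeVec]
  refine Finset.sum_nonpos fun k _ => ?_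
  by_cases h : G.graph.Adj i k
  · exact mul_nonpos_of_nonneg_of_nonpos (G.weightMatrix_nonneg i k) (by linarith [hf k h])
  · rw [weightMatrix_eq_zero h, zero_mul]

theorem two_mul_dotProduct_laplacian_mulVec (G : WeightedGraph V) (g f : V → ℝ) :
    2 * (g ⬝ᵥ G.laplacian *ᵥ f)
      = ∑ i, ∑ k, G.weightMatrix i k * ((g i - g k) * (f i - f k)) := by
  have hdot : g ⬝ᵥ G.laplacian *ᵥ f = ∑ i, ∑ k, G.weightMatrix i k * (g i * (f i - f k)) := by
    simp only [dotProduct, laplacian_mulVec_apply, Finset.mul_sum, mul_left_comm]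
  have hswap : g ⬝ᵥ G.laplacian *ᵥ f = ∑ i, ∑ k, G.weightMatrix i k * (g k * (f k - f i)) := by
    rw [hdot, Finset.sum_comm]
    simp only [G.isSymm_weightMatrix.apply]
  rw [two_mul]
  nth_rewrite 1 [hdot]
  simp only [hswap, ← Finset.sum_add_distrib, ← mul_add]
  refine Finset.sum_congr rfl fun i _ => Finset.sum_congr rfl fun k _ => ?_
  ring

theorem sum_laplacian_mulVec_eq_zero {S : Finset V}
    (hS : ∀ i k, G.graph.Adj i k → (i ∈ S ↔ k ∈ S)) (f : V → ℝ) :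
    ∑ i ∈ S, (G.laplacian *ᵥ f) i = 0 := by
  set g : V → ℝ := fun i => if i ∈ S then 1 else 0 with hg
  have hdot : ∑ i ∈ S, (G.laplacian *ᵥ f) i = g ⬝ᵥ G.laplacian *ᵥ f := by
    simp only [hg, dotProduct, ite_mul, one_mul, zero_mul, Finset.sum_ite_mem, Finset.univ_inter]
  have hform : 2 * (g ⬝ᵥ G.laplacian *ᵥ f) = 0 := by
    rw [two_mul_dotProduct_laplacian_mulVec]
    refine Finset.sum_eq_zero fun i _ => Finset.sum_eq_zero fun k _ =>
      weightMatrix_mul_eq_zero_iff.2 fun h => ?_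
    simp only [hg, hS i k h, sub_self, zero_mul]
  linarith

theorem eq_of_adj_of_dotProduct_laplacian_mulVec_eq_zero {f : V → ℝ}
    (hf : f ⬝ᵥ G.laplacian *ᵥ f = 0) {i k : V} (h : G.graph.Adj i k) : f i = f k := by
  have hnonneg (i k) : 0 ≤ G.weightMatrix i k * ((f i - f k) * (f i - f k)) :=
    mul_nonneg (G.weightMatrix_nonneg i k) (mul_self_nonneg _)
  have hsum : ∑ i, ∑ k, G.weightMatrix i k * ((f i - f k) * (f i - f k)) = 0 := by
    rw [← two_mul_dotProduct_laplacian_mulVec, hf, mul_zero]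
  have hi := (Finset.sum_eq_zero_iff_of_nonneg fun i _ =>
    Finset.sum_nonneg fun k _ => hnonneg i k).1 hsum i (Finset.mem_univ i)
  have hik := (Finset.sum_eq_zero_iff_of_nonneg fun k _ => hnonneg i k).1 hi k (Finset.mem_univ k)
  exact sub_eq_zero.1 (mul_self_eq_zero.1 (weightMatrix_mul_eq_zero_iff.1 hik h))

theorem eq_zero_of_laplacian_mulVec_eq_zero (hG : G.graph.Preconnected) {f : V → ℝ}
    (hf : ∀ i, f i = 0 ∨ (G.laplacian *ᵥ f) i = 0) {j : V} (hj : f j = 0) : f = 0 := by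
  have henergy : f ⬝ᵥ G.laplacian *ᵥ f = 0 :=
    Finset.sum_eq_zero fun i _ => mul_eq_zero.2 (hf i)
  suffices hzero : ∀ i, f i = 0 from funext hzero
  intro i
  obtain ⟨p⟩ := hG i j
  induction p with
  | nil => exact hj
  | cons h _ ih => rw [eq_of_adj_of_dotProduct_laplacian_mulVec_eq_zero henergy h, ih hj]

theorem two_le_sum_two_sub_degreeVec {f : V → ℝ} {S : Finset V}
    (hS : ∀ i k, G.graph.Adj i k → (i ∈ S ↔ k ∈ S)) {m : V} (hm : m ∈ S)
    (hfm : ∀ k, G.graph.Adj m k → G⁻¹.weightMatrix m k ≤ f k - f m)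
    (hf : ∀ i ∈ S, i ≠ m → (G.laplacian *ᵥ f) i = 2 - G.degreeVec i) :
    2 ≤ ∑ i ∈ S, (2 - G.degreeVec i) := by
  have herase : ∑ i ∈ S.erase m, (G.laplacian *ᵥ f) i = ∑ i ∈ S.erase m, (2 - G.degreeVec i) :=
    Finset.sum_congr rfl fun i hi => hf i (Finset.mem_of_mem_erase hi) (Finset.ne_of_mem_erase hi)
  have htotal := sum_laplacian_mulVec_eq_zero hS f
  rw [← Finset.add_sum_erase S _ hm, herase] at htotal
  rw [← Finset.add_sum_erase S _ hm]
  linarith [laplacian_mulVec_apply_le_neg_degreeVec hfm]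

namespace IsDistanceMatrix

variable {E : Matrix V V ℝ}

theorem laplacian_mul_apply_self (hE : G⁻¹.IsDistanceMatrix E) (hG : G.graph.IsAcyclic) (i : V) :
    (G.laplacian * E) i i = -G.degreeVec i := by
  rw [eq_neg_iff_add_eq_zero]
  refine (G.laplacian_mulVec_apply_add_degreeVec (E.col i) i).trans <|
    Finset.sum_eq_zero fun k _ => weightMatrix_mul_eq_zero_iff.2 fun h => ?_
  rw [Matrix.col_apply, Matrix.col_apply, hE.apply_self, hE.isSymm.apply, hE.apply_of_adj hG h,
    zero_sub, neg_add_cancel]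

theorem laplacian_mul_apply_of_ne (hE : G⁻¹.IsDistanceMatrix E) (hG : G.graph.IsAcyclic)
    {i j : V} (hij : i ≠ j) : (G.laplacian * E) i j = 2 - G.degreeVec i := by
  obtain ⟨k, hk, hkj, hlj⟩ := hE.exists_adj_apply_eq_add hG hij
  have hother (l) (hlk : l ≠ k) :
      G.weightMatrix i l * (E i j - E l j + G⁻¹.weightMatrix i l) = 0 :=
    weightMatrix_mul_eq_zero_iff.2 fun hl => by rw [hlj l hlk hl]; ring
  have hwk : G.weightMatrix i k * G⁻¹.weightMatrix i k = 1 := by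
    rw [inv_weightMatrix_apply, mul_inv_cancel₀ (weightMatrix_pos (G := G) hk).ne']
  rw [eq_sub_iff_add_eq]
  calc (G.laplacian * E) i j + G.degreeVec i
      = ∑ l, G.weightMatrix i l * (E i j - E l j + G⁻¹.weightMatrix i l) :=
        G.laplacian_mulVec_apply_add_degreeVec (E.col j) i
    _ = G.weightMatrix i k * (E i j - E k j + G⁻¹.weightMatrix i k) :=
        Fintype.sum_eq_single k hother
    _ = 2 * (G.weightMatrix i k * G⁻¹.weightMatrix i k) := by rw [hkj]; ring
    _ = 2 := by rw [hwk, mul_one]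

theorem laplacian_mul_add_two_smul_one (hE : G⁻¹.IsDistanceMatrix E) (hG : G.graph.IsAcyclic) :
    G.laplacian * E + (2 : ℝ) • (1 : Matrix V V ℝ)
      = Matrix.vecMulVec ((2 : ℝ) • (1 : V → ℝ) - G.degreeVec) (1 : V → ℝ) := by
  ext i j
  simp only [Matrix.add_apply, Matrix.smul_apply, Matrix.vecMulVec_apply, Pi.sub_apply,
    Pi.smul_apply, Pi.one_apply, smul_eq_mul, mul_one]
  obtain rfl | hij := eq_or_ne i j
  · rw [hE.laplacian_mul_apply_self hG, Matrix.one_apply_eq]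
    ring
  · rw [hE.laplacian_mul_apply_of_ne hG hij, Matrix.one_apply_ne hij]
    ring

end IsDistanceMatrix

end Laplacian

section LinearOrder

variable [Fintype V] [LinearOrder V] {D E : Matrix V V ℝ}

theorem two_le_sum_two_sub_degreeVec_of_forall_lt (hsymm : D.IsSymm) (hdiag : ∀ i, D i i = 0)
    (hD : ∀ i j, G.graph.Adj i j → G⁻¹.weightMatrix i j ≤ D i j)
    (hupper : ∀ i j, i < j → (G.laplacian * D) i j = 2 - G.degreeVec i) {S : Finset V}
    (hS : ∀ i k, G.graph.Adj i k → (i ∈ S ↔ k ∈ S)) (hne : S.Nonempty) :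
    2 ≤ ∑ i ∈ S, (2 - G.degreeVec i) := by
  refine two_le_sum_two_sub_degreeVec (f := D.col (S.max' hne)) hS (S.max'_mem hne)
    (fun k hk => ?_) fun i hi him => hupper i _ ((S.le_max' i hi).lt_of_ne him)
  rw [Matrix.col_apply, Matrix.col_apply, hdiag, sub_zero, hsymm.apply]
  exact hD _ k hk

theorem connected_of_forall_lt [Nonempty V] (hsymm : D.IsSymm) (hdiag : ∀ i, D i i = 0)
    (hD : ∀ i j, G.graph.Adj i j → G⁻¹.weightMatrix i j ≤ D i j)
    (hupper : ∀ i j, i < j → (G.laplacian * D) i j = 2 - G.degreeVec i) :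
    G.graph.Connected := by
  classical
  obtain ⟨t, ht⟩ := Finite.exists_max (id : V → V)
  have hmem (C : G.graph.ConnectedComponent) : t ∈ C.supp := by
    by_contra htC
    have hclosed (i k) (h : G.graph.Adj i k) : i ∈ C.supp.toFinset ↔ k ∈ C.supp.toFinset := by
      simpa only [Set.mem_toFinset] using C.mem_supp_congr_adj h
    have hzero : ∑ i ∈ C.supp.toFinset, (2 - G.degreeVec i) = 0 := by
      rw [← sum_laplacian_mulVec_eq_zero hclosed (D.col t)]
      refine Finset.sum_congr rfl fun i hi => (hupper i t ((ht i).lt_of_ne ?_)).symm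
      rintro rfl
      exact htC (Set.mem_toFinset.1 hi)
    have htwo := two_le_sum_two_sub_degreeVec_of_forall_lt hsymm hdiag hD hupper hclosed
      (Set.toFinset_nonempty.2 C.nonempty_supp)
    linarith
  have hreach (i) : G.graph.Reachable t i :=
    SimpleGraph.ConnectedComponent.exact (hmem (G.graph.connectedComponentMk i))
  exact ⟨fun i j => (hreach i).symm.trans (hreach j)⟩

theorem isTree_of_forall_lt [Nonempty V] (hsymm : D.IsSymm) (hdiag : ∀ i, D i i = 0)
    (hD : ∀ i j, G.graph.Adj i j → G⁻¹.weightMatrix i j ≤ D i j)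
    (hupper : ∀ i j, i < j → (G.laplacian * D) i j = 2 - G.degreeVec i) :
    G.graph.IsTree := by
  classical
  refine isTree_of_connected_of_sum_degree_add_two_le
    (connected_of_forall_lt hsymm hdiag hD hupper) ?_
  have h := two_le_sum_two_sub_degreeVec_of_forall_lt hsymm hdiag hD hupper
    (S := Finset.univ) (fun _ _ _ => by simp only [Finset.mem_univ]) Finset.univ_nonempty
  simp only [degreeVec_apply, Finset.sum_sub_distrib, Finset.sum_const, Finset.card_univ,
    nsmul_eq_mul, ← Nat.cast_sum] at h
  have h' : (∑ i, G.graph.degree i : ℕ) + (2 : ℝ) ≤ 2 * Fintype.card V := by linarith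
  exact_mod_cast h'

theorem eq_of_laplacian_mul_apply_eq (hG : G.graph.Preconnected) (hDsymm : D.IsSymm)
    (hEsymm : E.IsSymm) (hdiag : ∀ i, D i i = E i i)
    (hupper : ∀ i j, i < j → (G.laplacian * D) i j = (G.laplacian * E) i j) : D = E := by
  suffices hcol : ∀ j, D.col j - E.col j = 0 from
    Matrix.ext fun i j => sub_eq_zero.1 (congrFun (hcol j) i)
  intro j
  induction j using WellFoundedGT.induction with
  | ind j ih =>
    refine eq_zero_of_laplacian_mulVec_eq_zero hG (fun i => ?_) (sub_eq_zero.2 (hdiag j))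
    obtain hij | rfl | hji := lt_trichotomy i j
    · right
      rw [Matrix.mulVec_sub]
      exact sub_eq_zero.2 (hupper i j hij)
    · exact Or.inl (sub_eq_zero.2 (hdiag i))
    · left
      rw [Pi.sub_apply, Matrix.col_apply, Matrix.col_apply, ← hDsymm.apply, ← hEsymm.apply]
      exact congrFun (ih i hji) j

end LinearOrder

end WeightedGraph

theorem theorem2_general {V : Type*} [Fintype V] [LinearOrder V] [Nonempty V]
    (G : WeightedGraph V) (D : Matrix V V ℝ) (hsymm : D.IsSymm) (hdiag : ∀ i, D i i = 0)
    (hD : ∀ i j, G.graph.Adj i j → G⁻¹.weightMatrix i j ≤ D i j)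
    (hupper : ∀ i j, i < j → (G.laplacian * D) i j = 2 - G.degreeVec i) :
    G.graph.IsTree ∧ G⁻¹.IsDistanceMatrix D ∧
      G.laplacian * D + (2 : ℝ) • (1 : Matrix V V ℝ)
        = Matrix.vecMulVec ((2 : ℝ) • (1 : V → ℝ) - G.degreeVec) (1 : V → ℝ) := by
  have hT : G.graph.IsTree := WeightedGraph.isTree_of_forall_lt hsymm hdiag hD hupper
  have hpre := hT.connected.preconnected
  obtain ⟨E, hE⟩ := WeightedGraph.exists_isDistanceMatrix (G := G⁻¹) hpre
  obtain rfl : D = E :=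
    WeightedGraph.eq_of_laplacian_mul_apply_eq hpre hsymm hE.isSymm
      (fun i => by rw [hdiag, hE.apply_self]) fun i j hij => by
        rw [hupper i j hij, hE.laplacian_mul_apply_of_ne hT.isAcyclic hij.ne]
  exact ⟨hT, hE, hE.laplacian_mul_add_two_smul_one hT.isAcyclic⟩

theorem theorem2 (n : ℕ) (hn : 1 ≤ n) (G : WeightedGraph (Fin n))
    (D : Matrix (Fin n) (Fin n) ℝ) (hsymm : D.IsSymm) (hdiag : ∀ i, D i i = 0)
    (hD : ∀ i j, G⁻¹.weightMatrix i j ≤ D i j)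
    (hupper : strictUpper (G.laplacian * D + (2 : ℝ) • (1 : Matrix (Fin n) (Fin n) ℝ)
      - Matrix.vecMulVec ((2 : ℝ) • (1 : Fin n → ℝ) - G.degreeVec) (1 : Fin n → ℝ)) = 0) :
    G.graph.IsTree ∧ G⁻¹.IsDistanceMatrix D ∧
      G.laplacian * D + (2 : ℝ) • (1 : Matrix (Fin n) (Fin n) ℝ)
        = Matrix.vecMulVec ((2 : ℝ) • (1 : Fin n → ℝ) - G.degreeVec) (1 : Fin n → ℝ) := by
  have : Nonempty (Fin n) := ⟨⟨0, hn⟩⟩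
  exact theorem2_general G D hsymm hdiag (fun i j _ => hD i j) fun i j hij => by
    simpa [strictUpper, hij, hij.ne, sub_eq_zero] using congrFun₂ hupper i j
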